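/- Proposition 5.1. Let $0<q<1$ and write $(a;q)_\infty=\prod_{k=0}^{\infty}(1-aq^k)$ for $a\in\mathbb C$. The $q^{-1}$-Hermite polynomials $h_n(x|q)$ are defined by $h_0(x|q)=1$, $h_1(x|q)=2x$ and $$h_{n+1}(x|q)=2x\,h_n(x|q)-q^{-n}(1-q^n)\,h_{n-1}(x|q)\qquad(n\ge 1).$$ Let $\mu$ be any solution of the $q^{-1}$-Hermite moment problem, that is, any probability measure on $\mathbb R$ with finite moments of every order such that $\int_{\mathbb R} h_m(x|q)h_n(x|q)\,d\mu(x)=0$ for all $m\ne n$. For $t\in\mathbb C$ and $x\in\mathbb R$ put $$\chi_t(x)=\bigl(-t(\sqrt{x^2+1}+x);q\bigr)_\infty\,\bigl(t(\sqrt{x^2+1}-x);q\bigr)_\infty .$$ Let $t_1,t_2,t_3,t_4\in\mathbb C$ satisfy $|t_1t_3|<q^{3/2}$ and $|t_2t_4|<q^{3/2}$ (this holds in particular if $|t_i|<q^{3/4}$ for $i=1,\dots,4$). Then $\chi_{t_1}\chi_{t_2}\chi_{t_3}\chi_{t_4}\in L^1(\mu)$ and $$\int_{\mathbb R}\chi_{t_1}\chi_{t_2}\chi_{t_3}\chi_{t_4}\,d\mu=\frac{\prod_{1\le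 j<k\le 4}(-t_jt_k/q;q)_\infty}{(t_1t_2t_3t_4q^{-3};q)_\infty}.$$ -/

import Mathlib

open MeasureTheory

noncomputable section

/-- The infinite `q`-shifted factorial `(a; q)_∞ = ∏_{k ≥ 0} (1 - a q^k)`.  It is used for
`0 < q < 1` only, where the product converges absolutely for every complex `a`. -/
def qShiftedFactorialInf (a : ℂ) (q : ℝ) : ℂ :=
  ∏' k : ℕ, (1 - a * (q : ℂ) ^ k)

/-- The `q⁻¹`-Hermite polynomials `h_n(x|q)`, given by `h_0 = 1`, `h_1 = 2x` and
`h_{n+1} = 2x h_n - q^{-n} (1 - q^n) h_{n-1}` for `n ≥ 1`. -/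
def qInvHermite (q : ℝ) : ℕ → ℝ → ℝ
  | 0, _ => 1
  | 1, x => 2 * x
  | n + 2, x =>
      2 * x * qInvHermite q (n + 1) x
        - (q ^ (n + 1))⁻¹ * (1 - q ^ (n + 1)) * qInvHermite q n x

/-- The solutions of the `q⁻¹`-Hermite moment problem: the probability measures on the real line
with moments of every order, for which the polynomials `h_n(·|q)` are orthogonal.
(The values `∫ h_n² dμ` are then determined by the recurrence and `μ(ℝ) = 1`.) -/
structure IsQInvHermiteSolution (q : ℝ) (μ : Measure ℝ) : Prop where
  isProbabilityMeasure : IsProbabilityMeasure μ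
  integrable_pow : ∀ n : ℕ, Integrable (fun x : ℝ => x ^ n) μ
  orthogonal : ∀ m n : ℕ, m ≠ n → ∫ x, qInvHermite q m x * qInvHermite q n x ∂μ = 0

/-- `χ_t(x) = (-t (√(x² + 1) + x), t (√(x² + 1) - x); q)_∞`, that is
`(-t e^ξ, t e^{-ξ}; q)_∞` with `x = sinh ξ`. -/
def qChi (q : ℝ) (t : ℂ) (x : ℝ) : ℂ :=
  qShiftedFactorialInf (-t * ((√(x ^ 2 + 1) + x : ℝ) : ℂ)) q *
    qShiftedFactorialInf (t * ((√(x ^ 2 + 1) - x : ℝ) : ℂ)) q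

end

/-!
The proof rests on a single identity, the bilinear (Mehler) generating function of the
homogeneous polynomials `H_n(a, b)` given by `H_0 = 1`, `H_1 = a + b` and
`H_{n+1} = (a + b) H_n + a b q^{-n} (1 - q^n) H_{n-1}`:
for `|abcd| < q`,
`∑ q^{n(n-1)/2} H_n(a, b) H_n(c, d) / (q; q)_n = (-ac, -ad, -bc, -bd; q)_∞ / (abcd/q; q)_∞`
(`mehler_formula`). It is used twice.

* As `h_n(x|q) = H_n(e^ξ, -e^{-ξ})` for `x = sinh ξ`, the choice `a = e^ξ`, `b = -e^{-ξ}` expands a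
  product of two factors pointwise in the orthogonal polynomials (`hasSum_qChi_mul`):
  `χ_s χ_t = (-st/q; q)_∞ ∑ q^{n(n-1)/2} H_n(s, t) h_n / (q; q)_n`.
* The recurrence gives `∫ h_n² dμ = (q; q)_n q^{-n(n+1)/2}` for every solution `μ`, and the bound
  `H_n(s, t) = O(q^{-n²/4} ρ^n)` for `ρ² > |st|` shows that the expansion converges absolutely in
  `L²(μ)` when `|st| < q^{3/2}`. Hence the expansions of `χ_{t₁} χ_{t₃}` and `χ_{t₂} χ_{t₄}` may be
  multiplied and integrated term by term (`integral_mul_of_hasSum_orthogonal`), whether or not `μ`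
  is determined by its moments or the polynomials are dense in `L²(μ)`. What is left is
  `(-t₁t₃/q, -t₂t₄/q; q)_∞ ∑ q^{n(n-1)/2} H_n(t₁, t₃) H_n(t₂/q, t₄/q) / (q; q)_n`,
  and the Mehler formula sums this series as well.

The Mehler formula itself comes from a `q`-difference equation. The summands satisfy a recurrence of
order four (`mehlerTerm_recurrence`), equivalent to
`(1 - Px²/q) (1 - Px²) F(x) = (1 + acx) (1 + adx) (1 + bcx) (1 + bdx) F(qx)` for
`F(x) = ∑ (n-th summand) x^n` and `P = abcd`. Iterating it from `x = 1` and using `F(q^N) → 1`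
produces the infinite products.

Powers of `q^{1/4}` occur in the bounds, which are therefore stated for `q = κ ^ 4`.
-/

noncomputable section

open Filter Topology

variable {q : ℝ}

/-! ### The bilinear summand and its recurrence -/

/-- The homogeneous form `H_n(a, b)` of the `q⁻¹`-Hermite polynomials, equal to
`∑ k, [n choose k]_q q^{k(k-n)} a^k b^{n-k}`; it is encoded by its three-term recurrence. The
`q⁻¹`-Hermite polynomial is the case `a + b = 2x`, `a b = -1`. -/
def qInvRogersSzego (q : ℝ) (a b : ℂ) : ℕ → ℂ
  | 0 => 1
  | 1 => a + b
  | n + 2 => (a + b) * qInvRogersSzego q a b (n + 1) +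
      ((q : ℂ) ^ (n + 1))⁻¹ * (1 - (q : ℂ) ^ (n + 1)) * (a * b) * qInvRogersSzego q a b n

/-- The finite `q`-shifted factorial `(q; q)_n = ∏_{k = 1}^n (1 - q^k)`. -/
def qFact (q : ℝ) (n : ℕ) : ℝ := ∏ k ∈ Finset.range n, (1 - q ^ (k + 1))

/-- The `n`-th summand `q^{n(n-1)/2} H_n(a, b) H_n(c, d) / (q; q)_n` of the Mehler formula. -/
def mehlerTerm (q : ℝ) (a b c d : ℂ) (n : ℕ) : ℂ :=
  (q : ℂ) ^ n.choose 2 / qFact q n * (qInvRogersSzego q a b n * qInvRogersSzego q c d n)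

/-- The sequence `f` shifted by `k` places and padded with zeros: the coefficients of
`x^k ∑ f_n x^n`. -/
def delay (k : ℕ) (f : ℕ → ℂ) (n : ℕ) : ℂ := if n < k then 0 else f (n - k)


theorem one_sub_pow_pos (hq0 : 0 < q) (hq1 : q < 1) (n : ℕ) : 0 < 1 - q ^ (n + 1) :=
  sub_pos.2 (pow_lt_one₀ hq0.le hq1 n.succ_ne_zero)

theorem qFact_pos (hq0 : 0 < q) (hq1 : q < 1) (n : ℕ) : 0 < qFact q n :=
  Finset.prod_pos fun k _ => one_sub_pow_pos hq0 hq1 k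

theorem qFact_succ (n : ℕ) : qFact q (n + 1) = qFact q n * (1 - q ^ (n + 1)) :=
  Finset.prod_range_succ _ _

@[simp] theorem qInvRogersSzego_zero (a b : ℂ) : qInvRogersSzego q a b 0 = 1 := rfl

@[simp] theorem qInvRogersSzego_one (a b : ℂ) : qInvRogersSzego q a b 1 = a + b := rfl

theorem qInvRogersSzego_add_two (a b : ℂ) (n : ℕ) : qInvRogersSzego q a b (n + 2) =
    (a + b) * qInvRogersSzego q a b (n + 1) +
      ((q : ℂ) ^ (n + 1))⁻¹ * (1 - (q : ℂ) ^ (n + 1)) * (a * b) * qInvRogersSzego q a b n := rfl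

/-- The generic case of the order-four recurrence, as an identity between values: `u`, `v` are five
consecutive values of two sequences `H_n`, `w` those of the weight `q^{n(n-1)/2} / (q; q)_n`,
`r = q` and `Q = q^n`. -/
theorem bilinear_recurrence {r Q S p S' p' w0 w1 w2 w3 w4 u0 u1 u2 u3 u4 v0 v1 v2 v3 v4 : ℂ}
    (hr : r ≠ 0) (hQ : Q ≠ 0)
    (hu2 : u2 = S * u1 + (Q * r)⁻¹ * (1 - Q * r) * p * u0)
    (hu3 : u3 = S * u2 + (Q * r ^ 2)⁻¹ * (1 - Q * r ^ 2) * p * u1)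
    (hu4 : u4 = S * u3 + (Q * r ^ 3)⁻¹ * (1 - Q * r ^ 3) * p * u2)
    (hv2 : v2 = S' * v1 + (Q * r)⁻¹ * (1 - Q * r) * p' * v0)
    (hv3 : v3 = S' * v2 + (Q * r ^ 2)⁻¹ * (1 - Q * r ^ 2) * p' * v1)
    (hv4 : v4 = S' * v3 + (Q * r ^ 3)⁻¹ * (1 - Q * r ^ 3) * p' * v2)
    (hw1 : w1 * (1 - Q * r) = w0 * Q) (hw2 : w2 * (1 - Q * r ^ 2) = w1 * (Q * r))
    (hw3 : w3 * (1 - Q * r ^ 3) = w2 * (Q * r ^ 2))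
    (hw4 : w4 * (1 - Q * r ^ 4) = w3 * (Q * r ^ 3)) :
    w4 * (u4 * v4) - p * p' * (1 + 1 / r) * (w2 * (u2 * v2)) + (p * p') ^ 2 / r * (w0 * (u0 * v0)) =
      Q * r ^ 4 * (w4 * (u4 * v4)) + S * S' * (Q * r ^ 3 * (w3 * (u3 * v3)))
        + (p * (S' ^ 2 - 2 * p') + p' * (S ^ 2 - 2 * p) + 2 * (p * p'))
          * (Q * r ^ 2 * (w2 * (u2 * v2)))
        + p * p' * S * S' * (Q * r * (w1 * (u1 * v1))) + (p * p') ^ 2 * (Q * (w0 * (u0 * v0))) := by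
  -- Solving for the weights downwards keeps all denominators powers of `q`.
  have g2 : w2 = w3 * (1 - Q * r ^ 3) / (Q * r ^ 2) := by rw [hw3]; field_simp
  have g1 : w1 = w2 * (1 - Q * r ^ 2) / (Q * r) := by rw [hw2]; field_simp
  have g0 : w0 = w1 * (1 - Q * r) / Q := by rw [hw1]; field_simp
  have key : w3 * (Q * r ^ 3) * (u4 * v4) - p * p' * (1 + 1 / r) * (w2 * (u2 * v2))
        + (p * p') ^ 2 / r * (w0 * (u0 * v0)) =
      S * S' * (Q * r ^ 3 * (w3 * (u3 * v3)))
        + (p * (S' ^ 2 - 2 * p') + p' * (S ^ 2 - 2 * p) + 2 * (p * p'))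
          * (Q * r ^ 2 * (w2 * (u2 * v2)))
        + p * p' * S * S' * (Q * r * (w1 * (u1 * v1)))
        + (p * p') ^ 2 * (Q * (w0 * (u0 * v0))) := by
    subst g0 g1 g2
    subst hu4 hv4 hu3 hv3 hu2 hv2
    field_simp
    ring
  linear_combination key + u4 * v4 * hw4

/-- Coefficientwise form of the `q`-difference equation `mehler_functional_equation`. -/
theorem mehlerTerm_recurrence (hq0 : 0 < q) (hq1 : q < 1) (a b c d : ℂ) (n : ℕ) :
    let f := mehlerTerm q a b c d
    let g := fun n => (q : ℂ) ^ n * f n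
    let P := a * b * (c * d)
    f n - P * (1 + 1 / q) * delay 2 f n + P ^ 2 / q * delay 4 f n =
      g n + (a + b) * (c + d) * delay 1 g n
        + (a * b * (c ^ 2 + d ^ 2) + c * d * (a ^ 2 + b ^ 2) + 2 * P) * delay 2 g n
        + P * (a + b) * (c + d) * delay 3 g n + P ^ 2 * delay 4 g n := by
  have hqc : (q : ℂ) ≠ 0 := by exact_mod_cast hq0.ne'
  have h1 (n : ℕ) : (1 - (q : ℂ) ^ (n + 1)) ≠ 0 := by
    exact_mod_cast (one_sub_pow_pos hq0 hq1 n).ne'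
  have hw (n : ℕ) : (q : ℂ) ^ (n + 1).choose 2 / qFact q (n + 1) * (1 - (q : ℂ) ^ (n + 1)) =
      (q : ℂ) ^ n.choose 2 / qFact q n * (q : ℂ) ^ n := by
    have hF : (qFact q n : ℂ) ≠ 0 := by exact_mod_cast (qFact_pos hq0 hq1 n).ne'
    have := h1 n
    rw [qFact_succ, Nat.choose_succ_succ' n 1, Nat.choose_one_right, pow_add]
    push_cast
    field_simp
  intro f g P
  have e1 := h1 0
  have e2 := h1 1
  have e3 := h1 2
  -- For `n < 4` some of the shifted terms are padding zeros, so these cases are separate.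
  match n with
  | 0 => simp [f, g, delay]
  | 1 =>
    simp only [f, g, P, delay, mehlerTerm, qInvRogersSzego, qFact]
    simp
    generalize (q : ℂ) = r at *
    simp at e1 e2 e3
    field_simp
    ring
  | 2 =>
    simp only [f, g, P, delay, mehlerTerm, qInvRogersSzego, qFact, Finset.prod_range_succ]
    simp
    generalize (q : ℂ) = r at *
    simp at e1 e2 e3
    field_simp
    ring
  | 3 =>
    simp only [f, g, P, delay, mehlerTerm, qInvRogersSzego, qFact, Finset.prod_range_succ]
    simp [Nat.choose]
    generalize (q : ℂ) = r at *
    simp at e1 e2 e3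
    field_simp
    ring
  | m + 4 =>
    have k := bilinear_recurrence (r := q) (Q := (q : ℂ) ^ m) hqc (pow_ne_zero _ hqc)
      (u0 := qInvRogersSzego q a b m) (u1 := qInvRogersSzego q a b (m + 1))
      (v0 := qInvRogersSzego q c d m) (v1 := qInvRogersSzego q c d (m + 1))
      (S := a + b) (p := a * b) (S' := c + d) (p' := c * d)
      (u2 := qInvRogersSzego q a b (m + 2)) (u3 := qInvRogersSzego q a b (m + 3))
      (u4 := qInvRogersSzego q a b (m + 4))
      (v2 := qInvRogersSzego q c d (m + 2)) (v3 := qInvRogersSzego q c d (m + 3))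
      (v4 := qInvRogersSzego q c d (m + 4))
      (by rw [qInvRogersSzego_add_two, pow_succ])
      (by rw [qInvRogersSzego_add_two, pow_add _ m 2])
      (by rw [qInvRogersSzego_add_two, pow_add _ m 3])
      (by rw [qInvRogersSzego_add_two, pow_succ])
      (by rw [qInvRogersSzego_add_two, pow_add _ m 2])
      (by rw [qInvRogersSzego_add_two, pow_add _ m 3]) (hw m)
      (by simpa only [pow_succ, mul_assoc, pow_zero, one_mul] using hw (m + 1))
      (by simpa only [pow_succ, mul_assoc, pow_zero, one_mul] using hw (m + 2))
      (by simpa only [pow_succ, mul_assoc, pow_zero, one_mul] using hw (m + 3))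
    have d1 : delay 1 g (m + 4) = g (m + 3) := by simp [delay]
    have d2 (g : ℕ → ℂ) : delay 2 g (m + 4) = g (m + 2) := by simp [delay]
    have d3 : delay 3 g (m + 4) = g (m + 1) := by simp [delay]
    have d4 (g : ℕ → ℂ) : delay 4 g (m + 4) = g m := by simp [delay]
    rw [d1, d2, d2, d3, d4, d4]
    simp only [f, g, P, mehlerTerm]
    linear_combination k

/-! ### The `q`-difference equation -/

theorem hasSum_delay (k : ℕ) {f : ℕ → ℂ} {x : ℂ} (hf : Summable fun n => f n * x ^ n) :
    HasSum (fun n => delay k f n * x ^ n) (x ^ k * ∑' n, f n * x ^ n) := by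
  rw [← hasSum_nat_add_iff' k]
  have h0 : ∑ i ∈ Finset.range k, delay k f i * x ^ i = 0 :=
    Finset.sum_eq_zero fun i hi => by simp [delay, Finset.mem_range.1 hi]
  rw [h0, sub_zero]
  refine (hf.hasSum.mul_left (x ^ k)).congr_fun fun n => ?_
  simp only [delay, Nat.not_lt.2 (Nat.le_add_left k n), if_false, Nat.add_sub_cancel, pow_add]
  ring

theorem mehler_functional_equation (hq0 : 0 < q) (hq1 : q < 1) (a b c d : ℂ)
    (hf : Summable (mehlerTerm q a b c d)) {x : ℂ} (hx : ‖x‖ ≤ 1) :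
    (1 - a * b * (c * d) / q * x ^ 2) * (1 - a * b * (c * d) * x ^ 2) *
        ∑' n, mehlerTerm q a b c d n * x ^ n =
      (1 + a * c * x) * (1 + a * d * x) * (1 + b * c * x) * (1 + b * d * x) *
        ∑' n, mehlerTerm q a b c d n * (q * x) ^ n := by
  have hs {y : ℂ} (hy : ‖y‖ ≤ 1) : Summable fun n => mehlerTerm q a b c d n * y ^ n := by
    refine .of_norm_bounded hf.norm fun n => ?_
    rw [norm_mul, norm_pow]
    exact mul_le_of_le_one_right (norm_nonneg _) (pow_le_one₀ (norm_nonneg _) hy)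
  have hqx : ‖(q : ℂ) * x‖ ≤ 1 := by
    rw [norm_mul, Complex.norm_real, Real.norm_of_nonneg hq0.le]
    exact mul_le_one₀ hq1.le (norm_nonneg _) hx
  have hS := hs hx
  have hT : Summable fun n => (q : ℂ) ^ n * mehlerTerm q a b c d n * x ^ n := by
    refine (hs hqx).congr fun n => ?_
    rw [mul_pow]
    ring
  have hT' : ∑' n, mehlerTerm q a b c d n * (q * x) ^ n =
      ∑' n, (q : ℂ) ^ n * mehlerTerm q a b c d n * x ^ n :=
    tsum_congr fun n => by rw [mul_pow]; ring
  rw [hT']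
  have l := ((hS.hasSum.sub ((hasSum_delay 2 hS).mul_left (a * b * (c * d) * (1 + 1 / q)))).add
    ((hasSum_delay 4 hS).mul_left ((a * b * (c * d)) ^ 2 / q)))
  have r := ((((hT.hasSum.add ((hasSum_delay 1 hT).mul_left ((a + b) * (c + d)))).add
    ((hasSum_delay 2 hT).mul_left
      (a * b * (c ^ 2 + d ^ 2) + c * d * (a ^ 2 + b ^ 2) + 2 * (a * b * (c * d))))).add
    ((hasSum_delay 3 hT).mul_left (a * b * (c * d) * (a + b) * (c + d)))).add
    ((hasSum_delay 4 hT).mul_left ((a * b * (c * d)) ^ 2)))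
  have e := l.unique (r.congr_fun fun n => ?_)
  · linear_combination e
  · linear_combination x ^ n * mehlerTerm_recurrence hq0 hq1 a b c d n

/-! ### Infinite products -/

theorem summable_qShiftedFactorialInf (hq0 : 0 < q) (hq1 : q < 1) (a : ℂ) :
    Summable fun k : ℕ => ‖-(a * (q : ℂ) ^ k)‖ := by
  simp only [norm_neg, norm_mul, norm_pow, Complex.norm_real, Real.norm_of_nonneg hq0.le]
  exact (summable_geometric_of_lt_one hq0.le hq1).mul_left _

theorem tendsto_qShiftedFactorialInf (hq0 : 0 < q) (hq1 : q < 1) (a : ℂ) :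
    Tendsto (fun N => ∏ k ∈ Finset.range N, (1 - a * (q : ℂ) ^ k)) atTop
      (𝓝 (qShiftedFactorialInf a q)) := by
  have := (multipliable_one_add_of_summable
    (summable_qShiftedFactorialInf hq0 hq1 a)).tendsto_prod_tprod_nat
  simpa only [← sub_eq_add_neg, qShiftedFactorialInf] using this

theorem qShiftedFactorialInf_ne_zero (hq0 : 0 < q) (hq1 : q < 1) {a : ℂ} (ha : ‖a‖ < 1) :
    qShiftedFactorialInf a q ≠ 0 := by
  have := tprod_one_add_ne_zero_of_summable (fun k => ?_)
    (summable_qShiftedFactorialInf hq0 hq1 a)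
  · simpa only [← sub_eq_add_neg, qShiftedFactorialInf] using this
  · intro h
    have h1 : a * (q : ℂ) ^ k = 1 := by linear_combination -h
    have h2 := congrArg norm h1
    rw [norm_mul, norm_pow, Complex.norm_real, Real.norm_of_nonneg hq0.le, norm_one] at h2
    have h3 : ‖a‖ * q ^ k ≤ ‖a‖ :=
      mul_le_of_le_one_right (norm_nonneg _) (pow_le_one₀ hq0.le hq1.le)
    linarith

/-- The decreasing sequence `(q; q)_n` stays above its limit `(q; q)_∞ > 0`. -/
theorem exists_pos_le_qFact (hq0 : 0 < q) (hq1 : q < 1) : ∃ c, 0 < c ∧ ∀ n, c ≤ qFact q n := by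
  have ht := tendsto_qShiftedFactorialInf hq0 hq1 q
  have hn := qShiftedFactorialInf_ne_zero hq0 hq1 (a := q)
    (by rwa [Complex.norm_real, Real.norm_of_nonneg hq0.le])
  have hprod (n : ℕ) : ∏ k ∈ Finset.range n, (1 - (q : ℂ) * (q : ℂ) ^ k) = (qFact q n : ℂ) := by
    simp [qFact, pow_succ']
  simp only [hprod] at ht
  have ht' := ht.norm
  simp only [Complex.norm_real, Real.norm_of_nonneg (qFact_pos hq0 hq1 _).le] at ht'
  refine ⟨_, norm_pos_iff.2 hn, fun n => (antitone_nat_of_succ_le fun n => ?_).le_of_tendsto ht' n⟩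
  rw [qFact_succ]
  exact mul_le_of_le_one_right (qFact_pos hq0 hq1 n).le (by linarith [pow_pos hq0 (n + 1)])

/-! ### Summation of the bilinear series -/

/-- The Mehler formula with the denominator cleared, assuming only that the series converges. -/
theorem mehler_sum (hq0 : 0 < q) (hq1 : q < 1) (a b c d : ℂ)
    (hf : Summable (mehlerTerm q a b c d)) :
    qShiftedFactorialInf (a * b * (c * d) / q) q * ∑' n, mehlerTerm q a b c d n =
      qShiftedFactorialInf (-(a * c)) q * qShiftedFactorialInf (-(a * d)) q *
        qShiftedFactorialInf (-(b * c)) q * qShiftedFactorialInf (-(b * d)) q := by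
  have hqc : (q : ℂ) ≠ 0 := by exact_mod_cast hq0.ne'
  have hqn : ‖(q : ℂ)‖ < 1 := by rwa [Complex.norm_real, Real.norm_of_nonneg hq0.le]
  set F : ℂ → ℂ := fun x => ∑' n, mehlerTerm q a b c d n * x ^ n with hF
  have hF0 : Tendsto (fun N : ℕ => F ((q : ℂ) ^ N)) atTop (𝓝 1) := by
    have h0 : F 0 = 1 := by
      rw [hF]
      dsimp only
      rw [tsum_eq_single 0 fun n hn => by simp [hn]]
      simp [mehlerTerm, qFact]
    rw [← h0]
    refine tendsto_tsum_of_dominated_convergence hf.norm (fun n => ?_) (.of_forall fun N n => ?_)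
    · exact ((tendsto_pow_atTop_nhds_zero_of_norm_lt_one hqn).pow n).const_mul _
    · rw [norm_mul, norm_pow, norm_pow]
      exact mul_le_of_le_one_right (norm_nonneg _)
        (pow_le_one₀ (by positivity) (pow_le_one₀ (norm_nonneg _) hqn.le))
  -- Two factors of the denominator product are used up in each step, since
  -- `(1 - P q^{2k}/q) (1 - P q^{2k})` covers the exponents `2k` and `2k + 1`.
  have iter (N : ℕ) :
      (∏ k ∈ Finset.range (2 * N), (1 - a * b * (c * d) / q * (q : ℂ) ^ k)) * F 1 =
      ((∏ k ∈ Finset.range N, (1 - -(a * c) * (q : ℂ) ^ k)) *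
        (∏ k ∈ Finset.range N, (1 - -(a * d) * (q : ℂ) ^ k)) *
        (∏ k ∈ Finset.range N, (1 - -(b * c) * (q : ℂ) ^ k)) *
        ∏ k ∈ Finset.range N, (1 - -(b * d) * (q : ℂ) ^ k)) * F ((q : ℂ) ^ N) := by
    induction N with
    | zero => simp
    | succ N ih =>
      have fe := mehler_functional_equation hq0 hq1 a b c d hf (x := (q : ℂ) ^ N)
        (by rw [norm_pow]; exact pow_le_one₀ (norm_nonneg _) hqn.le)
      rw [← pow_succ'] at fe
      rw [show 2 * (N + 1) = 2 * N + 1 + 1 by ring]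
      simp only [Finset.prod_range_succ]
      have e2 : a * b * (c * d) / q * (q : ℂ) ^ (2 * N + 1) =
          a * b * (c * d) * ((q : ℂ) ^ N) ^ 2 := by
        field_simp
        ring
      have e1 : a * b * (c * d) / q * (q : ℂ) ^ (2 * N) =
          a * b * (c * d) / q * ((q : ℂ) ^ N) ^ 2 := by
        ring
      rw [e1, e2]
      change _ * F _ = _ * F _ at fe
      linear_combination (1 - a * b * (c * d) / q * ((q : ℂ) ^ N) ^ 2) *
        (1 - a * b * (c * d) * ((q : ℂ) ^ N) ^ 2) * ih +
        ((∏ k ∈ Finset.range N, (1 - -(a * c) * (q : ℂ) ^ k)) *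
        (∏ k ∈ Finset.range N, (1 - -(a * d) * (q : ℂ) ^ k)) *
        (∏ k ∈ Finset.range N, (1 - -(b * c) * (q : ℂ) ^ k)) *
        ∏ k ∈ Finset.range N, (1 - -(b * d) * (q : ℂ) ^ k)) * fe
  have hl := ((tendsto_qShiftedFactorialInf hq0 hq1 (a * b * (c * d) / q)).comp
    (tendsto_id.const_mul_atTop' two_pos)).mul_const (F 1)
  have hr := ((((tendsto_qShiftedFactorialInf hq0 hq1 (-(a * c))).mul
    (tendsto_qShiftedFactorialInf hq0 hq1 (-(a * d)))).mul
    (tendsto_qShiftedFactorialInf hq0 hq1 (-(b * c)))).mul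
    (tendsto_qShiftedFactorialInf hq0 hq1 (-(b * d)))).mul hF0
  have := tendsto_nhds_unique hl (hr.congr fun N => (iter N).symm)
  simpa [hF] using this

/-! ### Growth bounds and the Mehler formula -/

/-- Once `ε n + θ ≤ 1`, the maximum of two consecutive values no longer increases. -/
theorem bounded_of_two_step {y ε : ℕ → ℝ} {θ : ℝ} (hy : ∀ n, 0 ≤ y n) (hε : Tendsto ε atTop (𝓝 0))
    (hε0 : ∀ n, 0 ≤ ε n) (hθ0 : 0 ≤ θ) (hθ : θ < 1)
    (h : ∀ n, y (n + 2) ≤ ε n * y (n + 1) + θ * y n) : ∃ C, ∀ n, y n ≤ C := by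
  obtain ⟨N, hN⟩ := eventually_atTop.1 (hε.eventually_lt_const (sub_pos.2 hθ))
  have hM : ∀ n, y (N + n) ≤ max (y N) (y (N + 1)) ∧ y (N + n + 1) ≤ max (y N) (y (N + 1)) := by
    intro n
    induction n with
    | zero => simp
    | succ n ih =>
      refine ⟨ih.2, (h (N + n)).trans ?_⟩
      have h0 : 0 ≤ max (y N) (y (N + 1)) := (hy N).trans (le_max_left _ _)
      calc _ ≤ ε (N + n) * max (y N) (y (N + 1)) + θ * max (y N) (y (N + 1)) :=
            add_le_add (mul_le_mul_of_nonneg_left ih.2 (hε0 _)) (mul_le_mul_of_nonneg_left ih.1 hθ0)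
        _ = (ε (N + n) + θ) * max (y N) (y (N + 1)) := by ring
        _ ≤ _ := mul_le_of_le_one_left h0 (by linarith [hN (N + n) (by omega)])
  refine ⟨max (∑ i ∈ Finset.range N, y i) (max (y N) (y (N + 1))), fun n => ?_⟩
  rcases lt_or_ge n N with hn | hn
  · exact (Finset.single_le_sum (fun i _ => hy i) (Finset.mem_range.2 hn)).trans (le_max_left _ _)
  · obtain ⟨k, rfl⟩ := Nat.exists_eq_add_of_le hn
    exact (hM k).1.trans (le_max_right _ _)

/-- After multiplication by `q^{n²/4} ρ^{-n}` the recurrence has coefficients `O(q^{n/2})` and at most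
`|ab| / ρ² < 1`, so the normalized sequence is bounded. -/
theorem qInvRogersSzego_bound {κ : ℝ} (hκ0 : 0 < κ) (hκ1 : κ < 1) {ρ : ℝ} (hρ : 0 < ρ) {a b : ℂ}
    (hab : ‖a * b‖ < ρ ^ 2) :
    ∃ C, ∀ n, ‖qInvRogersSzego (κ ^ 4) a b n‖ * κ ^ (n ^ 2) ≤ C * ρ ^ n := by
  have hb := bounded_of_two_step
    (y := fun n => ‖qInvRogersSzego (κ ^ 4) a b n‖ * κ ^ (n ^ 2) / ρ ^ n)
    (ε := fun n => ‖a + b‖ / ρ * κ ^ (2 * n + 3)) (θ := ‖a * b‖ / ρ ^ 2)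
    (fun n => by positivity) ?_ (fun n => by positivity) (by positivity)
    ((div_lt_one (by positivity)).2 hab) fun n => ?_
  · obtain ⟨C, hC⟩ := hb
    exact ⟨C, fun n => (div_le_iff₀ (by positivity)).1 (hC n)⟩
  · have : Tendsto (fun n : ℕ => κ ^ (2 * n + 3)) atTop (𝓝 0) :=
      (tendsto_pow_atTop_nhds_zero_of_lt_one hκ0.le hκ1).comp
        (tendsto_atTop_mono (fun n => by dsimp; omega) tendsto_id)
    simpa using this.const_mul (‖a + b‖ / ρ)
  · have hle : ‖qInvRogersSzego (κ ^ 4) a b (n + 2)‖ ≤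
        ‖a + b‖ * ‖qInvRogersSzego (κ ^ 4) a b (n + 1)‖ +
          (κ ^ (4 * (n + 1)))⁻¹ * ‖a * b‖ * ‖qInvRogersSzego (κ ^ 4) a b n‖ := by
      rw [qInvRogersSzego_add_two]
      refine (norm_add_le _ _).trans ?_
      rw [norm_mul, norm_mul, norm_mul, norm_mul]
      have e1 : ‖(((κ ^ 4 : ℝ) : ℂ) ^ (n + 1))⁻¹‖ = (κ ^ (4 * (n + 1)))⁻¹ := by
        rw [norm_inv, norm_pow, Complex.norm_real, Real.norm_of_nonneg (by positivity), ← pow_mul]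
      have e2 : ‖1 - ((κ ^ 4 : ℝ) : ℂ) ^ (n + 1)‖ ≤ 1 := by
        rw [← Complex.ofReal_pow, ← Complex.ofReal_one, ← Complex.ofReal_sub, Complex.norm_real,
          Real.norm_of_nonneg]
        · linarith [pow_pos (pow_pos hκ0 4) (n + 1)]
        · exact sub_nonneg.2 (pow_le_one₀ (by positivity) (pow_le_one₀ hκ0.le hκ1.le))
      rw [e1]
      gcongr
      exact mul_le_of_le_one_right (by positivity) e2
    calc _ ≤ (‖a + b‖ * ‖qInvRogersSzego (κ ^ 4) a b (n + 1)‖ +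
          (κ ^ (4 * (n + 1)))⁻¹ * ‖a * b‖ * ‖qInvRogersSzego (κ ^ 4) a b n‖) *
            κ ^ ((n + 2) ^ 2) / ρ ^ (n + 2) := by gcongr
      _ = _ := by
        rw [show (n + 2) ^ 2 = n ^ 2 + 4 * (n + 1) by ring,
          show (n + 1) ^ 2 = n ^ 2 + 2 * n + 1 by ring]
        simp only [pow_add, pow_mul, mul_add, mul_one]
        field_simp
        ring

theorem qWeight_bound {κ : ℝ} (hκ0 : 0 < κ) (hκ1 : κ < 1) :
    ∃ C, 0 < C ∧ ∀ n : ℕ, (κ ^ 4) ^ n.choose 2 / qFact (κ ^ 4) n * κ ^ (2 * n) ≤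
      C * κ ^ (2 * n ^ 2) := by
  obtain ⟨c, hc, h⟩ := exists_pos_le_qFact (q := κ ^ 4) (by positivity)
    (pow_lt_one₀ hκ0.le hκ1 (by norm_num))
  refine ⟨c⁻¹, inv_pos.2 hc, fun n => ?_⟩
  have hch : 4 * n.choose 2 + 2 * n = 2 * n ^ 2 := by
    induction n with
    | zero => rfl
    | succ n ih =>
      rw [Nat.choose_succ_succ' n 1, Nat.choose_one_right]
      linear_combination ih
  rw [← pow_mul, div_mul_eq_mul_div, ← pow_add, hch, div_eq_inv_mul]
  gcongr
  exact h n

theorem summable_mehlerTerm {κ : ℝ} (hκ0 : 0 < κ) (hκ1 : κ < 1) {a b c d : ℂ}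
    (h : ‖a * b‖ * ‖c * d‖ < κ ^ 4) : Summable (mehlerTerm (κ ^ 4) a b c d) := by
  -- Room for `|ab| < ρ²` and `|cd| < σ²` with `ρ σ < κ²` in the growth bounds.
  obtain ⟨ε, hε, hε'⟩ : ∃ ε : ℝ, 0 < ε ∧ (‖a * b‖ + ε) * (‖c * d‖ + ε) < κ ^ 4 := by
    have hc : Tendsto (fun ε : ℝ => (‖a * b‖ + ε) * (‖c * d‖ + ε)) (𝓝[>] 0)
        (𝓝 ((‖a * b‖ + 0) * (‖c * d‖ + 0))) :=
      (Continuous.tendsto (by fun_prop) 0).mono_left nhdsWithin_le_nhds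
    have := (hc.eventually_lt_const (by simpa using h)).and self_mem_nhdsWithin
    obtain ⟨ε, h1, h2⟩ := this.exists
    exact ⟨ε, h2, h1⟩
  have hp : 0 < ‖a * b‖ + ε := by positivity
  have hp' : 0 < ‖c * d‖ + ε := by positivity
  obtain ⟨A, hA⟩ := qInvRogersSzego_bound hκ0 hκ1 (Real.sqrt_pos.2 hp) (a := a) (b := b)
    (by rw [Real.sq_sqrt hp.le]; linarith)
  obtain ⟨B, hB⟩ := qInvRogersSzego_bound hκ0 hκ1 (Real.sqrt_pos.2 hp') (a := c) (b := d)
    (by rw [Real.sq_sqrt hp'.le]; linarith)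
  obtain ⟨W, hW0, hW⟩ := qWeight_bound hκ0 hκ1
  set r := √(‖a * b‖ + ε)
  set s := √(‖c * d‖ + ε)
  have hrs : r * s / κ ^ 2 < 1 := by
    rw [div_lt_one (by positivity), ← Real.sqrt_mul hp.le, Real.sqrt_lt' (by positivity)]
    linarith
  refine .of_norm_bounded
    ((summable_geometric_of_lt_one (by positivity) hrs).mul_left (W * A * B)) fun n => ?_
  have hqF := qFact_pos (q := κ ^ 4) (by positivity) (pow_lt_one₀ hκ0.le hκ1 (by norm_num)) n
  have e : ‖mehlerTerm (κ ^ 4) a b c d n‖ = (κ ^ 4) ^ n.choose 2 / qFact (κ ^ 4) n *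
      (‖qInvRogersSzego (κ ^ 4) a b n‖ * ‖qInvRogersSzego (κ ^ 4) c d n‖) := by
    rw [mehlerTerm, norm_mul, norm_mul, norm_div, norm_pow, Complex.norm_real, Complex.norm_real,
      Real.norm_of_nonneg (by positivity), Real.norm_of_nonneg hqF.le]
  have hA0 : 0 ≤ A * r ^ n := le_trans (by positivity) (hA n)
  have key := mul_le_mul (hW n) (mul_le_mul (hA n) (hB n) (by positivity) hA0) (by positivity)
    (by positivity)
  have hK : 0 < κ ^ (2 * n ^ 2) * κ ^ (2 * n) := by positivity
  rw [e, div_pow, mul_pow, ← pow_mul]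
  refine le_of_mul_le_mul_right ?_ hK
  calc _ = _ := by ring
    _ ≤ _ := key
    _ = _ := by
      field_simp
      ring

theorem mehler_formula {κ : ℝ} (hκ0 : 0 < κ) (hκ1 : κ < 1) {a b c d : ℂ}
    (h : ‖a * b‖ * ‖c * d‖ < κ ^ 4) :
    HasSum (mehlerTerm (κ ^ 4) a b c d)
      (qShiftedFactorialInf (-(a * c)) (κ ^ 4) * qShiftedFactorialInf (-(a * d)) (κ ^ 4) *
        qShiftedFactorialInf (-(b * c)) (κ ^ 4) * qShiftedFactorialInf (-(b * d)) (κ ^ 4) /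
        qShiftedFactorialInf (a * b * (c * d) / (κ ^ 4 : ℝ)) (κ ^ 4)) := by
  have hq1 : κ ^ 4 < 1 := pow_lt_one₀ hκ0.le hκ1 (by norm_num)
  have hq0 : 0 < κ ^ 4 := by positivity
  have hs := summable_mehlerTerm hκ0 hκ1 h
  have hne : qShiftedFactorialInf (a * b * (c * d) / (κ ^ 4 : ℝ)) (κ ^ 4) ≠ 0 := by
    refine qShiftedFactorialInf_ne_zero hq0 hq1 ?_
    rwa [norm_div, norm_mul (a * b), Complex.norm_real, Real.norm_of_nonneg hq0.le, div_lt_one hq0]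
  rw [← mehler_sum hq0 hq1 a b c d hs, mul_div_cancel_left₀ _ hne]
  exact hs.hasSum


/-! ### Term-by-term integration of orthogonal expansions -/

/-- A pointwise convergent series that converges absolutely in `L¹` has an integrable sum. -/
theorem integrable_of_hasSum {α ι : Type*} [Countable ι] {m : MeasurableSpace α} {μ : Measure α}
    {F : ι → α → ℂ} {f : α → ℂ} (hF : ∀ i, Integrable (F i) μ)
    (hs : Summable fun i => ∫ x, ‖F i x‖ ∂μ) (hf : ∀ x, HasSum (fun i => F i x) (f x)) :
    Integrable f μ := by
  constructor
  · refine aestronglyMeasurable_of_tendsto_ae atTop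
      (f := fun (s : Finset ι) x => ∑ i ∈ s, F i x) (fun s => ?_) (.of_forall hf)
    exact Finset.aestronglyMeasurable_fun_sum s fun i _ => (hF i).1
  · have h1 : ∀ x, ‖f x‖ₑ ≤ ∑' i, ‖F i x‖ₑ := fun x => by
      rw [← (hf x).tsum_eq]
      exact enorm_tsum_le_tsum_enorm
    have h2 (i : ι) : ∫⁻ x, ‖F i x‖ₑ ∂μ = ENNReal.ofReal (∫ x, ‖F i x‖ ∂μ) :=
      (ofReal_integral_norm_eq_lintegral_enorm (hF i)).symm
    calc ∫⁻ x, ‖f x‖ₑ ∂μ ≤ ∫⁻ x, ∑' i, ‖F i x‖ₑ ∂μ := lintegral_mono h1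
      _ = ∑' i, ENNReal.ofReal (∫ x, ‖F i x‖ ∂μ) := by
        rw [lintegral_tsum fun i => (hF i).1.enorm]
        exact tsum_congr h2
      _ < ⊤ := by
        rw [← ENNReal.ofReal_tsum_of_nonneg (fun i => integral_nonneg fun x => norm_nonneg _) hs]
        exact ENNReal.ofReal_lt_top

/-- Cauchy–Schwarz in terms of bounds on the two `L²` norms. -/
theorem integral_norm_mul_le {α : Type*} {m : MeasurableSpace α} {μ : Measure α} {u v : α → ℝ}
    (hu : Integrable (fun x => u x * u x) μ) (hv : Integrable (fun x => v x * v x) μ)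
    {A B : ℝ} (hA : 0 < A) (hB : 0 < B)
    (hu' : ∫ x, u x * u x ∂μ ≤ A ^ 2) (hv' : ∫ x, v x * v x ∂μ ≤ B ^ 2) :
    ∫ x, ‖u x * v x‖ ∂μ ≤ A * B := by
  have hpt (x : α) : ‖u x * v x‖ ≤ B / (2 * A) * (u x * u x) + A / (2 * B) * (v x * v x) := by
    have h := sq_nonneg (B * |u x| - A * |v x|)
    have e : B / (2 * A) * (u x * u x) + A / (2 * B) * (v x * v x) - ‖u x * v x‖ =
        (B * |u x| - A * |v x|) ^ 2 / (2 * A * B) := by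
      rw [norm_mul, Real.norm_eq_abs, Real.norm_eq_abs, ← abs_mul_abs_self (u x),
        ← abs_mul_abs_self (v x)]
      field_simp
      ring
    have := div_nonneg h (by positivity : 0 ≤ 2 * A * B)
    linarith
  calc ∫ x, ‖u x * v x‖ ∂μ
      ≤ ∫ x, (B / (2 * A) * (u x * u x) + A / (2 * B) * (v x * v x)) ∂μ :=
        integral_mono_of_nonneg (.of_forall fun _ => norm_nonneg _)
          ((hu.const_mul _).add (hv.const_mul _)) (.of_forall hpt)
    _ = B / (2 * A) * ∫ x, u x * u x ∂μ + A / (2 * B) * ∫ x, v x * v x ∂μ := by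
        rw [integral_add (hu.const_mul _) (hv.const_mul _), integral_const_mul, integral_const_mul]
    _ ≤ B / (2 * A) * A ^ 2 + A / (2 * B) * B ^ 2 := by gcongr
    _ = A * B := by
        field_simp
        ring

/-- Parseval for two expansions in orthogonal functions that converge pointwise and absolutely in
`L²`. Completeness of the system is not needed, since the sums are given pointwise. -/
theorem integral_mul_of_hasSum_orthogonal {α : Type*} {m : MeasurableSpace α} {μ : Measure α}
    {φ : ℕ → α → ℝ} (hint : ∀ m n, Integrable (fun x => φ m x * φ n x) μ)
    (horth : ∀ m n, m ≠ n → ∫ x, φ m x * φ n x ∂μ = 0)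
    {N : ℕ → ℝ} (hN0 : ∀ n, 0 < N n) (hN : ∀ n, ∫ x, φ n x * φ n x ∂μ ≤ N n ^ 2)
    {a b : ℕ → ℂ} (ha : Summable fun n => ‖a n‖ * N n) (hb : Summable fun n => ‖b n‖ * N n)
    {f g : α → ℂ} (hf : ∀ x, HasSum (fun n => a n * (φ n x : ℂ)) (f x))
    (hg : ∀ x, HasSum (fun n => b n * (φ n x : ℂ)) (g x)) :
    Integrable (fun x => f x * g x) μ ∧
      HasSum (fun n => a n * b n * ((∫ x, φ n x * φ n x ∂μ : ℝ) : ℂ)) (∫ x, f x * g x ∂μ) := by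
  set F : ℕ × ℕ → α → ℂ := fun p x => a p.1 * b p.2 * ((φ p.1 x * φ p.2 x : ℝ) : ℂ) with hF
  have hFint (p : ℕ × ℕ) : Integrable (F p) μ := ((hint p.1 p.2).ofReal).const_mul _
  have hFsum (x : α) : HasSum (fun p => F p x) (f x * g x) := by
    have hs : Summable fun p : ℕ × ℕ => a p.1 * (φ p.1 x : ℂ) * (b p.2 * (φ p.2 x : ℂ)) :=
      summable_mul_of_summable_norm (f := fun n => a n * (φ n x : ℂ))
        (g := fun n => b n * (φ n x : ℂ)) (hf x).summable.norm (hg x).summable.norm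
    refine ((hf x).mul (hg x) hs).congr_fun fun p => ?_
    simp only [hF]
    push_cast
    ring
  have hFnorm : Summable fun p => ∫ x, ‖F p x‖ ∂μ := by
    refine Summable.of_nonneg_of_le (fun p => integral_nonneg fun x => norm_nonneg _) (fun p => ?_)
      (ha.mul_of_nonneg hb (fun n => mul_nonneg (norm_nonneg _) (hN0 n).le)
        (fun n => mul_nonneg (norm_nonneg _) (hN0 n).le))
    simp only [hF, norm_mul (a _ * b _), Complex.norm_real, integral_const_mul]
    calc _ ≤ ‖a p.1 * b p.2‖ * (N p.1 * N p.2) := by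
          gcongr
          exact integral_norm_mul_le (hint _ _) (hint _ _) (hN0 _) (hN0 _) (hN _) (hN _)
      _ = _ := by rw [norm_mul]; ring
  refine ⟨integrable_of_hasSum hFint hFnorm hFsum, ?_⟩
  have h := hasSum_integral_of_summable_integral_norm hFint hFnorm
  simp only [(hFsum _).tsum_eq] at h
  have hval (p : ℕ × ℕ) : ∫ x, F p x ∂μ =
      a p.1 * b p.2 * ((∫ x, φ p.1 x * φ p.2 x ∂μ : ℝ) : ℂ) := by
    simp only [hF]
    rw [integral_const_mul, integral_complex_ofReal]
  have hinj : Function.Injective fun n : ℕ => (n, n) := fun m n h => (Prod.mk.inj h).1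
  -- By orthogonality only the diagonal of the double series survives.
  rw [← hinj.hasSum_iff] at h
  · exact h.congr_fun fun n => (hval (n, n)).symm
  · rintro ⟨m, n⟩ hmn
    rw [hval, horth m n fun e => hmn ⟨m, by simp [e]⟩]
    simp

/-! ### The polynomials `h_n` and their norms -/

theorem qInvHermite_add_two (n : ℕ) (x : ℝ) : qInvHermite q (n + 2) x =
    2 * x * qInvHermite q (n + 1) x -
      (q ^ (n + 1))⁻¹ * (1 - q ^ (n + 1)) * qInvHermite q n x := rfl

theorem two_mul_qInvHermite (n : ℕ) (x : ℝ) : 2 * x * qInvHermite q (n + 1) x =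
    qInvHermite q (n + 2) x + (q ^ (n + 1))⁻¹ * (1 - q ^ (n + 1)) * qInvHermite q n x := by
  rw [qInvHermite_add_two]
  ring

theorem sqrt_add_mul_neg_sqrt_sub (x : ℝ) :
    ((√(x ^ 2 + 1) + x : ℝ) : ℂ) * -((√(x ^ 2 + 1) - x : ℝ) : ℂ) = -1 := by
  have h : (√(x ^ 2 + 1) + x) * -(√(x ^ 2 + 1) - x) = -1 := by
    linear_combination -Real.sq_sqrt (by positivity : 0 ≤ x ^ 2 + 1)
  exact_mod_cast h

theorem ofReal_qInvHermite (x : ℝ) (n : ℕ) : (qInvHermite q n x : ℂ) =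
    qInvRogersSzego q ((√(x ^ 2 + 1) + x : ℝ) : ℂ) (-((√(x ^ 2 + 1) - x : ℝ) : ℂ)) n := by
  have hab : ((√(x ^ 2 + 1) + x : ℝ) : ℂ) * -((√(x ^ 2 + 1) - x : ℝ) : ℂ) = -1 :=
    sqrt_add_mul_neg_sqrt_sub x
  have hsum : ((√(x ^ 2 + 1) + x : ℝ) : ℂ) + -((√(x ^ 2 + 1) - x : ℝ) : ℂ) = 2 * x := by
    push_cast
    ring
  induction n using Nat.twoStepInduction with
  | zero => simp [qInvHermite]
  | one => rw [qInvRogersSzego_one, hsum]; simp [qInvHermite]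
  | more n h1 h2 =>
    rw [qInvRogersSzego_add_two, hab, hsum, ← h1, ← h2, qInvHermite_add_two]
    push_cast
    ring

theorem qInvHermite_eq_eval (q : ℝ) (n : ℕ) :
    ∃ p : Polynomial ℝ, ∀ x, qInvHermite q n x = p.eval x := by
  induction n using Nat.twoStepInduction with
  | zero => exact ⟨1, fun x => by simp [qInvHermite]⟩
  | one => exact ⟨2 * .X, fun x => by simp [qInvHermite]⟩
  | more n h1 h2 =>
    obtain ⟨p, hp⟩ := h1
    obtain ⟨r, hr⟩ := h2
    exact ⟨2 * .X * r - .C ((q ^ (n + 1))⁻¹ * (1 - q ^ (n + 1))) * p, fun x => by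
      rw [qInvHermite_add_two, hp, hr]
      simp⟩

namespace IsQInvHermiteSolution

variable {μ : Measure ℝ}

theorem integrable_eval (hμ : IsQInvHermiteSolution q μ) (p : Polynomial ℝ) :
    Integrable (fun x => p.eval x) μ := by
  simp only [Polynomial.eval_eq_sum_range]
  exact integrable_finsetSum _ fun i _ => (hμ.integrable_pow i).const_mul _

theorem integrable_mul (hμ : IsQInvHermiteSolution q μ) (m n : ℕ) :
    Integrable (fun x => qInvHermite q m x * qInvHermite q n x) μ := by
  obtain ⟨p, hp⟩ := qInvHermite_eq_eval q m
  obtain ⟨r, hr⟩ := qInvHermite_eq_eval q n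
  simpa [hp, hr] using hμ.integrable_eval (p * r)

/-- The squared norm of `h_n`: pairing the recurrences of `h_{n+1}` and `h_{n+2}` expresses
`∫ 2x h_{n+1} h_n dμ` both as `∫ h_{n+1}² dμ` and as `q^{-n-1} (1 - q^{n+1}) ∫ h_n² dμ`. -/
theorem integral_sq (hμ : IsQInvHermiteSolution q μ) (hq0 : 0 < q) (n : ℕ) :
    ∫ x, qInvHermite q n x * qInvHermite q n x ∂μ = qFact q n / q ^ (n + 1).choose 2 := by
  have := hμ.isProbabilityMeasure
  have hq := hq0.ne'
  have hsub (m n k l : ℕ) (c : ℝ) :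
      ∫ x, (qInvHermite q m x * qInvHermite q n x +
        c * (qInvHermite q k x * qInvHermite q l x)) ∂μ =
      ∫ x, qInvHermite q m x * qInvHermite q n x ∂μ +
        c * ∫ x, qInvHermite q k x * qInvHermite q l x ∂μ := by
    rw [integral_add (hμ.integrable_mul _ _) ((hμ.integrable_mul _ _).const_mul _),
      integral_const_mul]
  induction n with
  | zero => simp [qInvHermite, qFact]
  | succ n ih =>
    have step : ∫ x, qInvHermite q (n + 1) x * qInvHermite q (n + 1) x ∂μ =
        (q ^ (n + 1))⁻¹ * (1 - q ^ (n + 1)) * ∫ x, qInvHermite q n x * qInvHermite q n x ∂μ := by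
      have hx : ∫ x, 2 * x * qInvHermite q (n + 1) x * qInvHermite q n x ∂μ =
          (q ^ (n + 1))⁻¹ * (1 - q ^ (n + 1)) *
            ∫ x, qInvHermite q n x * qInvHermite q n x ∂μ := by
        simp only [two_mul_qInvHermite, add_mul]
        simp only [mul_assoc ((q ^ (n + 1))⁻¹ * (1 - q ^ (n + 1)))]
        rw [hsub, hμ.orthogonal _ _ (by omega), zero_add]
      rw [← hx]
      cases n with
      | zero =>
        refine integral_congr_ae (.of_forall fun x => ?_)
        simp only [qInvHermite]
        ring
      | succ n =>
        calc _ = ∫ x, (qInvHermite q (n + 2) x * qInvHermite q (n + 2) x +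
              (q ^ (n + 1))⁻¹ * (1 - q ^ (n + 1)) *
                (qInvHermite q (n + 2) x * qInvHermite q n x)) ∂μ := by
              rw [hsub, hμ.orthogonal (n + 2) n (by omega), mul_zero, add_zero]
          _ = _ := by
              refine integral_congr_ae (.of_forall fun x => ?_)
              linear_combination -qInvHermite q (n + 2) x * two_mul_qInvHermite (q := q) n x
    rw [step, ih, qFact_succ, Nat.choose_succ_succ' (n + 1) 1, Nat.choose_one_right,
      pow_add q (n + 1)]
    field_simp

end IsQInvHermiteSolution

/-! ### Expansion of a product of two factors -/

theorem qInvRogersSzego_mul (z a b : ℂ) (n : ℕ) :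
    qInvRogersSzego q (z * a) (z * b) n = z ^ n * qInvRogersSzego q a b n := by
  induction n using Nat.twoStepInduction with
  | zero => simp
  | one => simp [mul_add]
  | more n h1 h2 =>
    rw [qInvRogersSzego_add_two, qInvRogersSzego_add_two, h1, h2]
    ring

/-- The coefficient of `h_n` in the expansion of `χ_s χ_t`, which is
`(-st/q; q)_∞ q^{n(n-1)/2} H_n(s, t) / (q; q)_n`. -/
def qChiCoeff (q : ℝ) (s t : ℂ) (n : ℕ) : ℂ :=
  qShiftedFactorialInf (-(s * t) / q) q * ((q : ℂ) ^ n.choose 2 / qFact q n) *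
    qInvRogersSzego q s t n

theorem hasSum_qChi_mul {κ : ℝ} (hκ0 : 0 < κ) (hκ1 : κ < 1) {s t : ℂ} (h : ‖s * t‖ < κ ^ 4)
    (x : ℝ) : HasSum (fun n => qChiCoeff (κ ^ 4) s t n * (qInvHermite (κ ^ 4) n x : ℂ))
      (qChi (κ ^ 4) s x * qChi (κ ^ 4) t x) := by
  have hq1 : κ ^ 4 < 1 := pow_lt_one₀ hκ0.le hκ1 (by norm_num)
  have hq0 : 0 < κ ^ 4 := by positivity
  set e : ℂ := ((√(x ^ 2 + 1) + x : ℝ) : ℂ) with he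
  set e' : ℂ := ((√(x ^ 2 + 1) - x : ℝ) : ℂ) with he'
  have hab : e * -e' = -1 := sqrt_add_mul_neg_sqrt_sub x
  have hne : qShiftedFactorialInf (-(s * t) / (κ ^ 4 : ℝ)) (κ ^ 4) ≠ 0 := by
    refine qShiftedFactorialInf_ne_zero hq0 hq1 ?_
    rwa [norm_div, norm_neg, Complex.norm_real, Real.norm_of_nonneg hq0.le, div_lt_one hq0]
  have hm := (mehler_formula hκ0 hκ1 (a := e) (b := -e') (c := s) (d := t)
    (by rwa [hab, norm_neg, norm_one, one_mul])).mul_left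
      (qShiftedFactorialInf (-(s * t) / (κ ^ 4 : ℝ)) (κ ^ 4))
  rw [hab, neg_one_mul, mul_div_cancel₀ _ hne] at hm
  have hval : qChi (κ ^ 4) s x * qChi (κ ^ 4) t x =
      qShiftedFactorialInf (-(e * s)) (κ ^ 4) * qShiftedFactorialInf (-(e * t)) (κ ^ 4) *
        qShiftedFactorialInf (-(-e' * s)) (κ ^ 4) * qShiftedFactorialInf (-(-e' * t)) (κ ^ 4) := by
    rw [qChi, qChi, ← he, ← he', show -(e * s) = -s * e by ring, show -(e * t) = -t * e by ring,
      show -(-e' * s) = s * e' by ring, show -(-e' * t) = t * e' by ring]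
    ring
  rw [hval]
  refine hm.congr_fun fun n => ?_
  rw [qChiCoeff, mehlerTerm, ofReal_qInvHermite]
  ring

/-- The expansion of `χ_s χ_t` converges absolutely in `L²(μ)`: the weight `κ^{-(n² + n)}` equals
`q^{-n(n+1)/4}`, which bounds the `L²` norm of `h_n`. -/
theorem summable_qChiCoeff {κ : ℝ} (hκ0 : 0 < κ) (hκ1 : κ < 1) {s t : ℂ} (h : ‖s * t‖ < κ ^ 6) :
    Summable fun n => ‖qChiCoeff (κ ^ 4) s t n‖ * (κ ^ (n ^ 2 + n))⁻¹ := by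
  obtain ⟨p, hp, hp'⟩ := exists_between h
  have hp0 : 0 < p := (norm_nonneg _).trans_lt hp
  obtain ⟨A, hA⟩ := qInvRogersSzego_bound hκ0 hκ1 (Real.sqrt_pos.2 hp0) (a := s) (b := t)
    (by rwa [Real.sq_sqrt hp0.le])
  obtain ⟨W, hW0, hW⟩ := qWeight_bound hκ0 hκ1
  set r := √p
  have hr : r / κ ^ 3 < 1 := by
    rw [div_lt_one (by positivity), Real.sqrt_lt' (by positivity), ← pow_mul]
    exact hp'
  set D := ‖qShiftedFactorialInf (-(s * t) / (κ ^ 4 : ℝ)) (κ ^ 4)‖ with hD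
  refine .of_nonneg_of_le (fun n => by positivity) (fun n => ?_)
    ((summable_geometric_of_lt_one (by positivity) hr).mul_left (D * W * A))
  have hqF := qFact_pos (q := κ ^ 4) (by positivity) (pow_lt_one₀ hκ0.le hκ1 (by norm_num)) n
  have e : ‖qChiCoeff (κ ^ 4) s t n‖ = D * ((κ ^ 4) ^ n.choose 2 / qFact (κ ^ 4) n) *
      ‖qInvRogersSzego (κ ^ 4) s t n‖ := by
    rw [qChiCoeff, norm_mul, norm_mul, norm_div, norm_pow, Complex.norm_real, Complex.norm_real,
      Real.norm_of_nonneg (by positivity : 0 ≤ κ ^ 4), Real.norm_of_nonneg hqF.le]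
  have key := mul_le_mul_of_nonneg_left
    (mul_le_mul (hW n) (hA n) (by positivity) (by positivity)) (norm_nonneg _ : 0 ≤ D)
  have hK : 0 < κ ^ (n ^ 2) * κ ^ (2 * n) := by positivity
  rw [e, div_pow]
  refine le_of_mul_le_mul_right ?_ hK
  calc _ = D * ((κ ^ 4) ^ n.choose 2 / qFact (κ ^ 4) n * κ ^ (2 * n) *
        (‖qInvRogersSzego (κ ^ 4) s t n‖ * κ ^ (n ^ 2))) * (κ ^ (n ^ 2 + n))⁻¹ := by ring
    _ ≤ D * (W * κ ^ (2 * n ^ 2) * (A * r ^ n)) * (κ ^ (n ^ 2 + n))⁻¹ := by gcongr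
    _ = _ := by
      rw [pow_add, mul_comm 2 (n ^ 2), mul_comm 2 n]
      simp only [pow_mul]
      field_simp
      ring

/-! ### The integral of four factors -/

/-- The integral of four factors, with the pairs `(s, t)` and `(u, v)` expanded. -/
theorem integral_qChi {κ : ℝ} (hκ0 : 0 < κ) (hκ1 : κ < 1) {μ : Measure ℝ}
    (hμ : IsQInvHermiteSolution (κ ^ 4) μ) {s t u v : ℂ} (hst : ‖s * t‖ < κ ^ 6)
    (huv : ‖u * v‖ < κ ^ 6) :
    Integrable (fun x => qChi (κ ^ 4) s x * qChi (κ ^ 4) t x *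
      (qChi (κ ^ 4) u x * qChi (κ ^ 4) v x)) μ ∧
    ∫ x, qChi (κ ^ 4) s x * qChi (κ ^ 4) t x * (qChi (κ ^ 4) u x * qChi (κ ^ 4) v x) ∂μ =
      qShiftedFactorialInf (-(s * t) / (κ ^ 4 : ℝ)) (κ ^ 4) *
      qShiftedFactorialInf (-(u * v) / (κ ^ 4 : ℝ)) (κ ^ 4) *
      (qShiftedFactorialInf (-(s * u) / (κ ^ 4 : ℝ)) (κ ^ 4) *
        qShiftedFactorialInf (-(s * v) / (κ ^ 4 : ℝ)) (κ ^ 4) *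
        qShiftedFactorialInf (-(t * u) / (κ ^ 4 : ℝ)) (κ ^ 4) *
        qShiftedFactorialInf (-(t * v) / (κ ^ 4 : ℝ)) (κ ^ 4) /
        qShiftedFactorialInf (s * t * (u * v) / ((κ ^ 4 : ℝ) : ℂ) ^ 3) (κ ^ 4)) := by
  have hq1 : κ ^ 4 < 1 := pow_lt_one₀ hκ0.le hκ1 (by norm_num)
  have hq0 : 0 < κ ^ 4 := by positivity
  have h64 : κ ^ 6 < κ ^ 4 := pow_lt_pow_right_of_lt_one₀ hκ0 hκ1 (by norm_num)
  have hqc : ((κ ^ 4 : ℝ) : ℂ) ≠ 0 := by exact_mod_cast hq0.ne'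
  have hN (n : ℕ) : ∫ x, qInvHermite (κ ^ 4) n x * qInvHermite (κ ^ 4) n x ∂μ ≤
      ((κ ^ (n ^ 2 + n))⁻¹) ^ 2 := by
    have hF : qFact (κ ^ 4) n ≤ 1 := Finset.prod_le_one
      (fun k _ => (one_sub_pow_pos hq0 hq1 k).le) fun k _ => by linarith [pow_pos hq0 (k + 1)]
    have hch : 4 * (n + 1).choose 2 = (n ^ 2 + n) * 2 := by
      induction n with
      | zero => rfl
      | succ n ih =>
        rw [Nat.choose_succ_succ' (n + 1) 1, Nat.choose_one_right]
        linear_combination ih (Finset.prod_le_one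
          (fun k _ => (one_sub_pow_pos hq0 hq1 k).le) fun k _ => by linarith [pow_pos hq0 (k + 1)])
    rw [hμ.integral_sq hq0, ← pow_mul, hch, inv_pow, ← pow_mul, div_eq_mul_inv]
    exact mul_le_of_le_one_left (by positivity) hF
  obtain ⟨hi, hs⟩ := integral_mul_of_hasSum_orthogonal hμ.integrable_mul hμ.orthogonal
    (fun n => by positivity) hN (summable_qChiCoeff hκ0 hκ1 hst) (summable_qChiCoeff hκ0 hκ1 huv)
    (hasSum_qChi_mul hκ0 hκ1 (hst.trans h64)) (hasSum_qChi_mul hκ0 hκ1 (huv.trans h64))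
  refine ⟨hi, hs.unique ?_⟩
  set r : ℂ := ((κ ^ 4 : ℝ) : ℂ) with hr
  -- The factor `q^{-n}` left over from the norms rescales the second pair of parameters by `1/q`.
  have hm := (mehler_formula hκ0 hκ1 (a := s) (b := t) (c := r⁻¹ * u) (d := r⁻¹ * v) ?_).mul_left
    (qShiftedFactorialInf (-(s * t) / r) (κ ^ 4) * qShiftedFactorialInf (-(u * v) / r) (κ ^ 4))
  · rw [← hr, show -(s * (r⁻¹ * u)) = -(s * u) / r by ring,
      show -(s * (r⁻¹ * v)) = -(s * v) / r by ring, show -(t * (r⁻¹ * u)) = -(t * u) / r by ring,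
      show -(t * (r⁻¹ * v)) = -(t * v) / r by ring,
      show s * t * (r⁻¹ * u * (r⁻¹ * v)) / r = s * t * (u * v) / r ^ 3 by
        field_simp] at hm
    refine hm.congr_fun fun n => ?_
    have hF : (qFact (κ ^ 4) n : ℂ) ≠ 0 := by exact_mod_cast (qFact_pos hq0 hq1 n).ne'
    rw [hμ.integral_sq hq0, qChiCoeff, qChiCoeff, mehlerTerm, qInvRogersSzego_mul,
      Nat.choose_succ_succ' n 1, Nat.choose_one_right, Complex.ofReal_div, 
      Complex.ofReal_pow (κ ^ 4), ← hr, pow_add, inv_pow]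
    field_simp
  · have e : ‖r⁻¹ * u * (r⁻¹ * v)‖ = ‖u * v‖ / (κ ^ 4) ^ 2 := by
      rw [show r⁻¹ * u * (r⁻¹ * v) = u * v / r ^ 2 by field_simp, norm_div, norm_pow, hr,
        Complex.norm_real, Real.norm_of_nonneg hq0.le]
    rw [e, ← mul_div_assoc, div_lt_iff₀ (by positivity)]
    calc _ < κ ^ 6 * κ ^ 6 := mul_lt_mul'' hst huv (norm_nonneg _) (norm_nonneg _)
      _ = _ := by ring

end

theorem proposition5p1 (q : ℝ) (hq0 : 0 < q) (hq1 : q < 1) (μ : Measure ℝ)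
    (hμ : IsQInvHermiteSolution q μ) (t₁ t₂ t₃ t₄ : ℂ) :
    (‖t₁ * t₃‖ < q ^ (3 / 2 : ℝ) → ‖t₂ * t₄‖ < q ^ (3 / 2 : ℝ) →
      Integrable (fun x : ℝ => qChi q t₁ x * qChi q t₂ x * qChi q t₃ x * qChi q t₄ x) μ ∧
      ∫ x : ℝ, qChi q t₁ x * qChi q t₂ x * qChi q t₃ x * qChi q t₄ x ∂μ =
        (qShiftedFactorialInf (-t₁ * t₂ / q) q * qShiftedFactorialInf (-t₁ * t₃ / q) q *
          qShiftedFactorialInf (-t₁ * t₄ / q) q * qShiftedFactorialInf (-t₂ * t₃ / q) q *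
          qShiftedFactorialInf (-t₂ * t₄ / q) q * qShiftedFactorialInf (-t₃ * t₄ / q) q) /
        qShiftedFactorialInf (t₁ * t₂ * t₃ * t₄ / (q : ℂ) ^ 3) q) ∧
    (‖t₁‖ < q ^ (3 / 4 : ℝ) → ‖t₂‖ < q ^ (3 / 4 : ℝ) →
      ‖t₃‖ < q ^ (3 / 4 : ℝ) → ‖t₄‖ < q ^ (3 / 4 : ℝ) →
      ‖t₁ * t₃‖ < q ^ (3 / 2 : ℝ) ∧ ‖t₂ * t₄‖ < q ^ (3 / 2 : ℝ)) := by
  constructor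
  · intro h13 h24
    obtain ⟨κ, hκ0, hκ1, rfl⟩ : ∃ κ : ℝ, 0 < κ ∧ κ < 1 ∧ q = κ ^ 4 := by
      refine ⟨q ^ (1 / 4 : ℝ), by positivity, Real.rpow_lt_one hq0.le hq1 (by norm_num), ?_⟩
      rw [← Real.rpow_natCast, ← Real.rpow_mul hq0.le]
      norm_num
    have h6 : (κ ^ 4) ^ (3 / 2 : ℝ) = κ ^ 6 := by
      rw [← Real.rpow_natCast, ← Real.rpow_mul hκ0.le, ← Real.rpow_natCast]
      norm_num
    rw [h6] at h13 h24
    have hre (x : ℝ) : qChi (κ ^ 4) t₁ x * qChi (κ ^ 4) t₂ x * qChi (κ ^ 4) t₃ x *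
        qChi (κ ^ 4) t₄ x = qChi (κ ^ 4) t₁ x * qChi (κ ^ 4) t₃ x *
          (qChi (κ ^ 4) t₂ x * qChi (κ ^ 4) t₄ x) := by ring
    simp only [hre]
    obtain ⟨hi, hv⟩ := integral_qChi hκ0 hκ1 hμ h13 h24
    refine ⟨hi, hv.trans ?_⟩
    rw [mul_comm t₃ t₂, show t₁ * t₃ * (t₂ * t₄) = t₁ * t₂ * t₃ * t₄ by ring]
    simp only [neg_mul]
    ring
  · intro h1 h2 h3 h4
    have e : q ^ (3 / 2 : ℝ) = q ^ (3 / 4 : ℝ) * q ^ (3 / 4 : ℝ) := by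
      rw [← Real.rpow_add hq0]
      norm_num
    rw [e, norm_mul, norm_mul]
    exact ⟨mul_lt_mul'' h1 h3 (norm_nonneg _) (norm_nonneg _),
      mul_lt_mul'' h2 h4 (norm_nonneg _) (norm_nonneg _)⟩
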